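/- Here a graph is a finite, non-empty, connected multigraph without loop edges. For a graph $G$ with vertex set $V(G)$ and edge set $E(G)$, let $\operatorname{Div}(G)$ be the free abelian group on $V(G)$; write a divisor as $D=\sum_{x\in V(G)} D(x)(x)$, put $\deg(D)=\sum_x D(x)$, and call $D$ effective, written $D\ge 0$, if $D(x)\ge 0$ for all $x$. For $f:V(G)\to\mathbb{Z}$ let $\operatorname{div}(f)=\sum_{x\in V(G)}\sum_{e=xy\in E(G)}(f(x)-f(y))\,(x)$, and write $D\sim D'$ if $D-D'=\operatorname{div}(f)$ for some $f$. Let $|D|=\{E\in\operatorname{Div}(G): E\ge 0,\ E\sim D\}$. Define $r(D)=-1$ if $|D|=\emptyset$, and otherwise let $r(D)$ be the largest integer $k$ such that $|D-E|\neq\emptyset$ for every effective divisor $E$ of degree $k$. The graph $G$ is called hyperelliptic if there is a divisor $D$ on $G$ with $\deg(D)=2$ and $r(D)=1$. For a positive integer $k$, let $\sigma_k(G)$ be the graph obtained from $G$ by replacing each edge by a path consisting of $k$ edges. **Corollary.** Let $G$ be a graph and let $k$ be a positive integer. Then $G$ is hyperelliptic if and only if $\sigma_k(G)$ is hyperelliptic.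 -/

import Mathlib

open scoped Graph

noncomputable section

namespace Graph

variable {α β : Type*}

/-- Divisors on a finite graph `G`: the free abelian group `ℤ^V(G)` on the vertices of `G`. -/
abbrev Divisor (G : Graph α β) : Type _ := V(G) → ℤ

/-- The degree of a divisor. -/
def divisorDegree (G : Graph α β) (D : G.Divisor) : ℤ := ∑ᶠ x, D x

/-- The divisor of an integer-valued function `f` on the vertices: its coefficient at `x` is the
sum of `f x - f y` over the edges `e = xy` incident to `x`, counted with multiplicity. -/
def divisorOf (G : Graph α β) (f : V(G) → ℤ) : G.Divisor := fun x =>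
  ∑ᶠ p : {p : E(G) × V(G) // G.IsLink p.1 x p.2}, (f x - f p.1.2)

/-- Linear equivalence of divisors: the difference is principal. -/
def LinearlyEquivalent (G : Graph α β) (D D' : G.Divisor) : Prop :=
  ∃ f : V(G) → ℤ, D - D' = G.divisorOf f

/-- The complete linear system `|D|`: the effective divisors linearly equivalent to `D`. -/
def linearSystem (G : Graph α β) (D : G.Divisor) : Set G.Divisor :=
  {E | 0 ≤ E ∧ G.LinearlyEquivalent E D}

/-- The effective divisors of degree `k`. -/
def effectiveDivisors (G : Graph α β) (k : ℤ) : Set G.Divisor :=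
  {E | 0 ≤ E ∧ G.divisorDegree E = k}

open Classical in
/-- The rank `r(D)`: it is `-1` if `|D|` is empty, and otherwise the largest integer `k` such that
`|D - E|` is non-empty for every effective divisor `E` of degree `k`. (On a finite non-empty graph
the set is then non-empty and bounded above, so that the supremum in `ℤ` is a maximum.) -/
def rank (G : Graph α β) (D : G.Divisor) : ℤ :=
  if (G.linearSystem D).Nonempty then
    sSup {k : ℤ | ∀ E ∈ G.effectiveDivisors k, (G.linearSystem (D - E)).Nonempty}
  else -1

/-- A graph is hyperelliptic if it has a divisor of degree `2` and rank `1`. -/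
def IsHyperelliptic (G : Graph α β) : Prop :=
  ∃ D : G.Divisor, G.divisorDegree D = 2 ∧ G.rank D = 1

/-- One end of the edge `e`, chosen arbitrarily. -/
def firstEnd (G : Graph α β) (e : E(G)) : V(G) :=
  ⟨(G.exists_isLink_of_mem_edgeSet e.2).choose,
    (G.exists_isLink_of_mem_edgeSet e.2).choose_spec.choose_spec.left_mem⟩

/-- The other end of the edge `e`. -/
def secondEnd (G : Graph α β) (e : E(G)) : V(G) :=
  ⟨(G.exists_isLink_of_mem_edgeSet e.2).choose_spec.choose,
    (G.exists_isLink_of_mem_edgeSet e.2).choose_spec.choose_spec.right_mem⟩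

lemma isLink_firstEnd_secondEnd (G : Graph α β) (e : E(G)) :
    G.IsLink e (G.firstEnd e) (G.secondEnd e) :=
  (G.exists_isLink_of_mem_edgeSet e.2).choose_spec.choose_spec

/-- The `i`-th vertex (`0 ≤ i ≤ k`) of the path of `k` edges that replaces the edge `e`. It starts
at one end of `e`, runs through the new vertices `(e, 1), …, (e, k - 1)`, and stops at the other
end of `e`. -/
def pathVertex (G : Graph α β) (k : ℕ) (e : E(G)) (i : ℕ) : V(G) ⊕ E(G) × Set.Ioo 0 k :=
  if h : i ∈ Set.Ioo 0 k then .inr (e, ⟨i, h⟩)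
  else if i = 0 then .inl (G.firstEnd e)
  else .inl (G.secondEnd e)

/-- The `k`-subdivision `σ_k(G)` (for `k ≥ 1`): every edge `e` of `G` is replaced by a path of
`k` edges `(e, 0), …, (e, k - 1)`, where `(e, i)` joins the `i`-th vertex of the path to
the next one. -/
def subdivision (G : Graph α β) (k : ℕ) :
    Graph (V(G) ⊕ E(G) × Set.Ioo 0 k) (E(G) × Fin k) where
  vertexSet := Set.univ
  edgeSet := Set.univ
  IsLink p u v := s(u, v) = s(G.pathVertex k p.1 p.2, G.pathVertex k p.1 (p.2 + 1))
  isLink_symm _ _ := ⟨fun _ _ h => Sym2.eq_swap.trans h⟩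
  eq_or_eq_of_isLink_of_isLink p u v u' v' h h' := by
    rcases Sym2.eq_iff.1 (h.trans h'.symm) with ⟨h, -⟩ | ⟨h, -⟩
    exacts [.inl h, .inr h]
  edge_mem_iff_exists_isLink p := ⟨fun _ => ⟨_, _, rfl⟩, fun _ => trivial⟩
  left_mem_of_isLink _ _ _ _ := trivial

end Graph

end

/-! In degree 2, rank at least 1 means that every vertex can receive a chip, and rank 2 holds
exactly when some divisor of degree 1 already has this property. So being hyperelliptic says that
`HasBasePointFree` holds for 2 and fails for 1 (`isHyperelliptic_iff`), and it suffices that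
subdivision preserves and reflects the property in these two degrees.

From `G` to the subdivision, a divisor is extended by zero and functions are interpolated linearly.
A chip reaches a new vertex of an edge `e` by combining the functions that bring chips to the two
ends of `e`: either their slopes along `e` differ and a maximum has a kink at the chosen point, or
chips reach both ends at once and can be moved inward together.

Back to `G`, the divisor may be taken to be `(x)` or `(x) + (z)` with `x` an old vertex, so at most
one chip is inside an edge. A function `F` is then almost convex along every path, and `F / k`
rounded down works on `G` once `z` is moved to an end of its edge (`exists_rounding`). -/

namespace Graph

/-! ### Laplacians and base point free divisors -/

section Laplacian

variable {V E : Type*} [DecidableEq V] [Fintype E]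

/-- The Laplacian of the finite multigraph on `V` whose edge `e` joins `a e` and `b e`. -/
def lap (a b : E → V) (f : V → ℤ) (x : V) : ℤ :=
  ∑ e, ((if a e = x then f (a e) - f (b e) else 0) + (if b e = x then f (b e) - f (a e) else 0))

lemma lap_add (a b : E → V) (f g : V → ℤ) : lap a b (f + g) = lap a b f + lap a b g := by
  funext x
  simp only [lap, Pi.add_apply, ← Finset.sum_add_distrib]
  refine Finset.sum_congr rfl fun e _ => ?_
  split_ifs <;> ring

lemma lap_neg (a b : E → V) (f : V → ℤ) : lap a b (-f) = -lap a b f := by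
  funext x
  simp only [lap, Pi.neg_apply, ← Finset.sum_neg_distrib]
  refine Finset.sum_congr rfl fun e _ => ?_
  split_ifs <;> ring

lemma lap_sub (a b : E → V) (f g : V → ℤ) : lap a b (f - g) = lap a b f - lap a b g := by
  rw [sub_eq_add_neg, lap_add, lap_neg, sub_eq_add_neg]

lemma lap_add_const (a b : E → V) (f : V → ℤ) (c : ℤ) :
    lap a b (f + fun _ => c) = lap a b f := by
  funext x
  simp [lap]

lemma sum_lap [Fintype V] (a b : E → V) (f : V → ℤ) : ∑ x, lap a b f x = 0 := by
  simp only [lap]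
  rw [Finset.sum_comm]
  refine Finset.sum_eq_zero fun e _ => ?_
  simp [Finset.sum_add_distrib]

/-- Where `f` attains the maximum, replacing `f` by the maximum can only raise the values at the
neighbours. Hence the functions `f` with `D - lap a b f` effective are closed under pointwise
maximum. -/
lemma lap_max_le_left (a b : E → V) (f g : V → ℤ) (x : V) (h : g x ≤ f x) :
    lap a b (fun v => max (f v) (g v)) x ≤ lap a b f x := by
  refine Finset.sum_le_sum fun e _ => add_le_add ?_ ?_
  · split_ifs with hx
    · subst hx; simp only [max_eq_left h]; have := le_max_left (f (b e)) (g (b e)); omega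
    · exact le_rfl
  · split_ifs with hx
    · subst hx; simp only [max_eq_left h]; have := le_max_left (f (a e)) (g (a e)); omega
    · exact le_rfl

lemma lap_max_le_right (a b : E → V) (f g : V → ℤ) (x : V) (h : f x ≤ g x) :
    lap a b (fun v => max (f v) (g v)) x ≤ lap a b g x := by
  simpa only [max_comm] using lap_max_le_left a b g f x h

lemma lap_max_le (a b : E → V) (f g D : V → ℤ) (hf : lap a b f ≤ D) (hg : lap a b g ≤ D) :
    lap a b (fun v => max (f v) (g v)) ≤ D := fun x => by
  rcases le_total (g x) (f x) with h | h
  · exact (lap_max_le_left a b f g x h).trans (hf x)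
  · exact (lap_max_le_right a b f g x h).trans (hg x)

/-- There is a base point free divisor of degree `d`: every vertex lies in the support of some
effective divisor linearly equivalent to it. -/
def HasBasePointFree [Fintype V] (a b : E → V) (d : ℤ) : Prop :=
  ∃ D : V → ℤ, ∑ x, D x = d ∧ ∀ x, ∃ f : V → ℤ, lap a b f ≤ D ∧ lap a b f x + 1 ≤ D x

lemma eq_single_of_sum_eq_one [Fintype V] {D : V → ℤ} (h0 : 0 ≤ D) (h : ∑ x, D x = 1) :
    ∃ z, D = Pi.single z 1 := by
  have : ∃ z, D z ≠ 0 := by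
    by_contra! hc
    simp [hc] at h
  obtain ⟨z, hz⟩ := this
  refine ⟨z, sub_eq_zero.1 ((Fintype.sum_eq_zero_iff_of_nonneg fun x => ?_).1 ?_)⟩
  · have h1 := h0 x
    rcases eq_or_ne x z with rfl | hx
    · simp at h1 ⊢; omega
    · simpa [hx] using h1
  · simp [h]

end Laplacian

/-! ### The Laplacian of the subdivision -/

section Subdivision

variable {V E : Type*}

/-- The `i`-th vertex of the path of `k` edges that replaces the edge `e` joining `a e` to `b e`. -/
def subPath (a b : E → V) (k : ℕ) (e : E) (i : ℕ) : V ⊕ E × Set.Ioo 0 k :=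
  if h : i ∈ Set.Ioo 0 k then .inr (e, ⟨i, h⟩) else if i = 0 then .inl (a e) else .inl (b e)

variable (a b : E → V) {k : ℕ}

lemma subPath_zero (e : E) : subPath a b k e 0 = .inl (a e) := by simp [subPath]

lemma subPath_last (hk : 0 < k) (e : E) : subPath a b k e k = .inl (b e) := by
  simp [subPath, hk.ne']

lemma subPath_mid (e : E) (i : Set.Ioo 0 k) : subPath a b k e i = .inr (e, i) := by
  simp only [subPath, dif_pos i.2]

lemma subPath_eq_inr {e e' : E} {j : ℕ} {i : Set.Ioo 0 k} :
    subPath a b k e j = .inr (e', i) ↔ e = e' ∧ j = i := by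
  unfold subPath
  split_ifs with h h' <;> simp [Subtype.ext_iff] <;> (intro _; rintro rfl; simp_all [i.2.1.ne'])

lemma subPath_eq_inl_of_lt {e : E} {j : ℕ} (hj : j < k) {v : V} :
    subPath a b k e j = .inl v ↔ j = 0 ∧ a e = v := by
  unfold subPath
  split_ifs <;> simp_all; omega

lemma subPath_succ_eq_inl_of_lt {e : E} {j : ℕ} (hj : j < k) {v : V} :
    subPath a b k e (j + 1) = .inl v ↔ j = k - 1 ∧ b e = v := by
  unfold subPath
  split_ifs with h h' <;> simp_all <;> omega

variable [DecidableEq V] [DecidableEq E] [Fintype E]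

/-- The Laplacian of the `k`-subdivision. -/
abbrev subLap (k : ℕ) : (V ⊕ E × Set.Ioo 0 k → ℤ) → V ⊕ E × Set.Ioo 0 k → ℤ :=
  lap (fun p : E × Fin k => subPath a b k p.1 p.2) (fun p => subPath a b k p.1 (p.2 + 1))

lemma subLap_add (f g : V ⊕ E × Set.Ioo 0 k → ℤ) :
    subLap a b k (f + g) = subLap a b k f + subLap a b k g := lap_add _ _ f g

lemma subLap_add_const (f : V ⊕ E × Set.Ioo 0 k → ℤ) (c : ℤ) :
    subLap a b k (f + fun _ => c) = subLap a b k f := lap_add_const _ _ f c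

lemma subLap_inl (hk : 0 < k) (H : V ⊕ E × Set.Ioo 0 k → ℤ) (v : V) :
    subLap a b k H (.inl v) =
      ∑ e, ((if a e = v then H (subPath a b k e 0) - H (subPath a b k e 1) else 0) +
        (if b e = v then H (subPath a b k e k) - H (subPath a b k e (k - 1)) else 0)) := by
  simp only [lap, Fintype.sum_prod_type]
  refine Finset.sum_congr rfl fun e _ => ?_
  rw [Finset.sum_add_distrib]
  congr 1
  · rw [Finset.sum_eq_single ⟨0, hk⟩]
    · simp [subPath_zero]
    · intro j _ hj
      rw [if_neg]
      rw [subPath_eq_inl_of_lt a b j.2]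
      exact fun h => hj (Fin.ext h.1)
    · simp
  · rw [Finset.sum_eq_single ⟨k - 1, by omega⟩]
    · simp [Nat.sub_add_cancel hk, subPath_last a b hk]
    · intro j _ hj
      rw [if_neg]
      rw [subPath_succ_eq_inl_of_lt a b j.2]
      exact fun h => hj (Fin.ext h.1)
    · simp

lemma subLap_inr (H : V ⊕ E × Set.Ioo 0 k → ℤ) (e : E) (i : Set.Ioo 0 k) :
    subLap a b k H (.inr (e, i)) = 2 * H (subPath a b k e i) - H (subPath a b k e (i - 1))
      - H (subPath a b k e (i + 1)) := by
  have h1 := i.2.1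
  have h2 := i.2.2
  simp only [lap, Fintype.sum_prod_type]
  rw [Finset.sum_eq_single e]
  · rw [Finset.sum_add_distrib, Finset.sum_eq_single ⟨i, h2⟩,
      Finset.sum_eq_single ⟨i - 1, by omega⟩]
    · have h3 : (i : ℕ) - 1 + 1 = i := Nat.sub_add_cancel h1
      simp only [h3, subPath_mid, if_true]
      ring
    · intro j _ hj
      rw [if_neg]
      rw [subPath_eq_inr]
      exact fun h => hj (Fin.ext (by simp; omega))
    · simp
    · intro j _ hj
      rw [if_neg]
      rw [subPath_eq_inr]
      exact fun h => hj (Fin.ext h.2)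
    · simp
  · intro e' _ he
    refine Finset.sum_eq_zero fun j _ => ?_
    simp [subPath_eq_inr, he]
  · simp

end Subdivision

variable {α β : Type*}

/-! ### From the rank to base point free divisors -/

section Transfer

variable {V E : Type*} [Fintype V] [DecidableEq V] [Fintype E]

lemma divisorOf_apply (G : Graph α β) (φ : V ≃ V(G)) (ψ : E ≃ E(G)) (a b : E → V)
    (hab : ∀ e, G.IsLink (ψ e) (φ (a e)) (φ (b e))) (f : V(G) → ℤ) (x : V) :
    G.divisorOf f (φ x) = lap a b (f ∘ φ) x := by
  classical
  have hl (e : E) (y : V) : G.IsLink (ψ e) (φ x) (φ y) ↔ (a e = x ∧ b e = y) ∨ (b e = x ∧ a e = y) := by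
    constructor
    · intro h
      rcases h.eq_and_eq_or_eq_and_eq (hab e) with ⟨h1, h2⟩ | ⟨h1, h2⟩
      · exact .inl ⟨(φ.injective (Subtype.ext h1)).symm, (φ.injective (Subtype.ext h2)).symm⟩
      · exact .inr ⟨(φ.injective (Subtype.ext h1)).symm, (φ.injective (Subtype.ext h2)).symm⟩
    · rintro (⟨rfl, rfl⟩ | ⟨rfl, rfl⟩)
      · exact hab e
      · exact (hab e).symm
  have h1 : G.divisorOf f (φ x) =
      ∑ᶠ p : {p : E × V // G.IsLink (ψ p.1) (φ x) (φ p.2)}, (f (φ x) - f (φ p.1.2)) := by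
    refine (finsum_comp_equiv ((ψ.prodCongr φ).subtypeEquiv fun p => ?_)).symm
    rfl
  rw [h1, finsum_eq_sum_of_fintype, lap]
  rw [← Finset.sum_subtype (Finset.univ.filter fun p : E × V => G.IsLink (ψ p.1) (φ x) (φ p.2))
    (by simp) (fun p : E × V => f (φ x) - f (φ p.2)), Finset.sum_filter, Fintype.sum_prod_type]
  refine Finset.sum_congr rfl fun e _ => ?_
  simp only [hl, Function.comp_apply]
  by_cases ha : a e = x <;> by_cases hb : b e = x
  · have : a e = b e := ha.trans hb.symm
    simp [ha, hb]
  all_goals simp [ha, hb]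

omit [DecidableEq V] [Fintype E] in
lemma divisorDegree_eq_sum (G : Graph α β) (φ : V ≃ V(G)) (D : G.Divisor) :
    G.divisorDegree D = ∑ x, D (φ x) := by
  rw [divisorDegree, ← finsum_comp_equiv φ, finsum_eq_sum_of_fintype]

lemma linearSystem_nonempty_iff (G : Graph α β) (φ : V ≃ V(G)) (ψ : E ≃ E(G)) (a b : E → V)
    (hab : ∀ e, G.IsLink (ψ e) (φ (a e)) (φ (b e))) (D : V → ℤ) :
    (G.linearSystem (D ∘ φ.symm)).Nonempty ↔ ∃ f : V → ℤ, lap a b f ≤ D := by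
  constructor
  · rintro ⟨F, hF, f, hf⟩
    refine ⟨-(f ∘ φ), fun x => ?_⟩
    have h1 := congrFun hf (φ x)
    have h2 := hF (φ x)
    rw [divisorOf_apply G φ ψ a b hab] at h1
    simp [lap_neg] at h1 h2 ⊢
    linarith
  · rintro ⟨f, hf⟩
    refine ⟨(D - lap a b f) ∘ φ.symm, fun x => by simpa using hf (φ.symm x), -(f ∘ φ.symm), ?_⟩
    funext x
    obtain ⟨x, rfl⟩ := φ.surjective x
    rw [divisorOf_apply G φ ψ a b hab]
    have : (-(f ∘ φ.symm)) ∘ φ = -f := by funext; simp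
    simp [this, lap_neg]

omit [Fintype V] [Fintype E] in
lemma le_sub_single_iff {D F : V → ℤ} {x : V} :
    F ≤ D - Pi.single x 1 ↔ F ≤ D ∧ F x + 1 ≤ D x := by
  constructor
  · refine fun h => ⟨h.trans (sub_le_self _ (Pi.single_nonneg.2 zero_le_one)), ?_⟩
    have := h x
    simp at this
    omega
  · rintro ⟨h, hx⟩ y
    rcases eq_or_ne y x with rfl | hy
    · simp; omega
    · simpa [hy] using h y

lemma sum_le_of_lap_le {a b : E → V} {f D : V → ℤ} (h : lap a b f ≤ D) : 0 ≤ ∑ x, D x :=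
  (sum_lap a b f).symm.le.trans (Finset.sum_le_sum fun x _ => h x)

/-- A divisor of degree one with a base point free linear system makes all vertices equivalent. -/
lemma exists_lap_eq_of_hasBasePointFree_one {a b : E → V} (h : HasBasePointFree a b 1) (x y : V) :
    ∃ f, lap a b f = Pi.single x 1 - Pi.single y 1 := by
  obtain ⟨D, hD, hf⟩ := h
  have key (x : V) : ∃ f, D - lap a b f = Pi.single x 1 := by
    obtain ⟨f, h1, h2⟩ := hf x
    refine ⟨f, sub_eq_zero.1 ((Fintype.sum_eq_zero_iff_of_nonneg fun y => ?_).1 ?_)⟩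
    · have := le_sub_single_iff.2 ⟨h1, h2⟩ y
      simp at this ⊢
      omega
    · simp [sum_lap, hD]
  obtain ⟨f, hf⟩ := key x
  obtain ⟨g, hg⟩ := key y
  exact ⟨g - f, by rw [lap_sub, ← hf, ← hg]; abel⟩

lemma isHyperelliptic_iff [Nonempty V] (G : Graph α β) (φ : V ≃ V(G)) (ψ : E ≃ E(G)) (a b : E → V)
    (hab : ∀ e, G.IsLink (ψ e) (φ (a e)) (φ (b e))) :
    G.IsHyperelliptic ↔ HasBasePointFree a b 2 ∧ ¬ HasBasePointFree a b 1 := by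
  have hS (D : V → ℤ) (k : ℤ) :
      (∀ F ∈ G.effectiveDivisors k, (G.linearSystem (D ∘ φ.symm - F)).Nonempty) ↔
        ∀ F : V → ℤ, 0 ≤ F → ∑ x, F x = k → ∃ f, lap a b f ≤ D - F := by
    constructor
    · intro h F hF hk
      rw [← linearSystem_nonempty_iff G φ ψ a b hab]
      exact h (F ∘ φ.symm) ⟨fun x => hF _, by rw [divisorDegree_eq_sum G φ]; simpa using hk⟩
    · rintro h F ⟨hF, hk⟩
      rw [divisorDegree_eq_sum G φ] at hk
      have := (linearSystem_nonempty_iff G φ ψ a b hab _).2 (h (F ∘ φ) (fun x => hF _) hk)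
      convert this using 2
      funext x
      simp
  have h1 (D : V → ℤ) : (∀ F : V → ℤ, 0 ≤ F → ∑ x, F x = 1 → ∃ f, lap a b f ≤ D - F) ↔
      ∀ x, ∃ f : V → ℤ, lap a b f ≤ D ∧ lap a b f x + 1 ≤ D x := by
    simp only [← le_sub_single_iff]
    constructor
    · exact fun h x => h _ (Pi.single_nonneg.2 zero_le_one) (by simp)
    · intro h F hF hk
      obtain ⟨z, rfl⟩ := eq_single_of_sum_eq_one hF hk
      exact h z
  obtain ⟨x₀⟩ := ‹Nonempty V›
  have hrank (D : V → ℤ) (hD : ∑ x, D x = 2) : G.rank (D ∘ φ.symm) = 1 ↔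
      (∀ x, ∃ f : V → ℤ, lap a b f ≤ D ∧ lap a b f x + 1 ≤ D x) ∧
      ¬ ∀ F : V → ℤ, 0 ≤ F → ∑ x, F x = 2 → ∃ f, lap a b f ≤ D - F := by
    have hle : ∀ k : ℤ, (∀ F : V → ℤ, 0 ≤ F → ∑ x, F x = k → ∃ f, lap a b f ≤ D - F) → k ≤ 2 := by
      intro k h
      by_contra! hk
      obtain ⟨f, hf⟩ := h (Pi.single x₀ k) (Pi.single_nonneg.2 (by omega)) (by simp)
      have := sum_le_of_lap_le hf
      simp [hD] at this
      omega
    rw [rank]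
    simp only [hS]
    constructor
    · intro h
      split_ifs at h with hne
      · rw [linearSystem_nonempty_iff G φ ψ a b hab] at hne
        -- No effective divisor has degree `-1`, so `-1` lies in the set vacuously and the supremum
        -- is attained.
        have hmem := Int.csSup_mem (s := {k : ℤ | ∀ F : V → ℤ, 0 ≤ F → ∑ x, F x = k →
            ∃ f, lap a b f ≤ D - F}) ⟨-1, fun F hF hk => ?_⟩ ⟨2, fun k hk => hle k hk⟩
        · refine ⟨(h1 D).1 (h ▸ hmem), fun h2 => ?_⟩
          have := le_csSup (s := {k : ℤ | ∀ F : V → ℤ, 0 ≤ F → ∑ x, F x = k →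
            ∃ f, lap a b f ≤ D - F}) ⟨2, fun k hk => hle k hk⟩ h2
          omega
        · have := Finset.sum_nonneg fun x (_ : x ∈ Finset.univ) => hF x
          omega
    · rintro ⟨h, h2⟩
      rw [if_pos ((linearSystem_nonempty_iff G φ ψ a b hab _).2 ((h x₀).imp fun _ h => h.1))]
      refine IsGreatest.csSup_eq ⟨(h1 D).2 h, fun k hk => ?_⟩
      have h3 : k ≠ 2 := by rintro rfl; exact h2 hk
      have := hle k hk
      omega
  constructor
  · rintro ⟨D, hD, hr⟩
    obtain ⟨D, rfl⟩ : ∃ D' : V → ℤ, D = D' ∘ φ.symm := ⟨D ∘ φ, by funext; simp⟩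
    have hD' : ∑ x, D x = 2 := by rw [divisorDegree_eq_sum G φ] at hD; simpa using hD
    obtain ⟨h, h2⟩ := (hrank D hD').1 hr
    refine ⟨⟨D, hD', h⟩, fun hone => h2 fun F hF hF2 => ?_⟩
    obtain ⟨x, hx⟩ : ∃ x, F x ≠ 0 := by
      by_contra! hc
      simp [hc] at hF2
    obtain ⟨y, hy⟩ : ∃ y, F - Pi.single x 1 = Pi.single y 1 := by
      refine eq_single_of_sum_eq_one (sub_nonneg.2 fun v => ?_) (by simp [hF2])
      have := hF v
      rcases eq_or_ne v x with rfl | hv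
      · simp at this ⊢; omega
      · simpa [hv] using this
    obtain ⟨f, hf⟩ := h x
    rw [← le_sub_single_iff] at hf
    obtain ⟨w, hw⟩ : ∃ w, D - Pi.single x 1 - lap a b f = Pi.single w 1 :=
      eq_single_of_sum_eq_one (sub_nonneg.2 hf) (by simp [hD', sum_lap])
    -- `D` is equivalent to `(x) + (w)`, and in the presence of `hone` the chip at `w` can be moved
    -- to `y`.
    obtain ⟨g, hg⟩ := exists_lap_eq_of_hasBasePointFree_one hone w y
    refine ⟨f + g, le_of_eq ?_⟩
    rw [lap_add, hg, ← hw, ← hy]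
    abel
  · rintro ⟨⟨D, hD, h⟩, hone⟩
    refine ⟨D ∘ φ.symm, by rw [divisorDegree_eq_sum G φ]; simpa using hD,
      (hrank D hD).2 ⟨h, fun h2 => hone ?_⟩⟩
    -- If `D` has rank 2, removing any one chip leaves a base point free divisor of degree 1.
    refine ⟨D - Pi.single x₀ 1, by simp [hD], fun x => ?_⟩
    simp only [← le_sub_single_iff, sub_sub]
    exact h2 _ (add_nonneg (Pi.single_nonneg.2 zero_le_one) (Pi.single_nonneg.2 zero_le_one))
      (by simp [Finset.sum_add_distrib])

end Transfer

/-! ### From the graph to its subdivision -/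

section Forward

variable {V E : Type*} [DecidableEq V] [Fintype E] [DecidableEq E]

/-- The linear interpolation of `k * f` to the subdivision. -/
def interpolate (a b : E → V) (k : ℕ) (f : V → ℤ) : V ⊕ E × Set.Ioo 0 k → ℤ :=
  Sum.elim (fun v => k * f v) fun p => (k - (p.2 : ℕ)) * f (a p.1) + (p.2 : ℕ) * f (b p.1)

variable (a b : E → V) {k : ℕ}

omit [DecidableEq V] [Fintype E] [DecidableEq E] in
lemma interpolate_subPath (hk : 0 < k) (f : V → ℤ) (e : E) {i : ℕ} (hi : i ≤ k) :
    interpolate a b k f (subPath a b k e i) = (k - i) * f (a e) + i * f (b e) := by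
  rcases Nat.eq_zero_or_pos i with rfl | h0
  · simp [subPath_zero, interpolate]
  · rcases hi.eq_or_lt with rfl | h1
    · simp [subPath_last a b hk, interpolate]
    · rw [subPath_mid a b e ⟨i, h0, h1⟩]
      simp [interpolate]

/-- The factor `k` makes each step along `e` equal to the integer `f (b e) - f (a e)`; constant
steps contribute nothing at interior points. -/
lemma subLap_interpolate (hk : 0 < k) (f : V → ℤ) :
    subLap a b k (interpolate a b k f) = Sum.elim (lap a b f) 0 := by
  funext x
  rcases x with v | ⟨e, i⟩
  · rw [subLap_inl a b hk]
    refine Finset.sum_congr rfl fun e _ => ?_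
    rw [interpolate_subPath a b hk f e (Nat.zero_le k), interpolate_subPath a b hk f e hk,
      interpolate_subPath a b hk f e le_rfl, interpolate_subPath a b hk f e (Nat.sub_le k 1)]
    push_cast [Nat.cast_sub hk]
    congr 2 <;> ring
  · have h1 := i.2.1
    have h2 := i.2.2
    rw [subLap_inr, interpolate_subPath a b hk f e h2.le, interpolate_subPath a b hk f e h2,
      interpolate_subPath a b hk f e (by omega)]
    push_cast [Nat.cast_sub h1]
    simp only [Sum.elim_inr, Pi.zero_apply]
    ring

/-- The function that moves one chip from each end of the edge `e₀` inward, as far as the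
`i`-th vertex of its path. -/
def tent (k : ℕ) (e₀ : E) (i : ℕ) : V ⊕ E × Set.Ioo 0 k → ℤ :=
  Sum.elim 0 fun p => 
    if p.1 = e₀ then -min (min ((p.2 : ℕ) : ℤ) (k - (p.2 : ℕ))) (min (i : ℤ) (k - i)) else 0

omit [DecidableEq V] [Fintype E] in
lemma tent_subPath (e₀ e : E) (i : Set.Ioo 0 k) {j : ℕ} (hj : j ≤ k) :
    tent k e₀ i (subPath a b k e j) =
      if e = e₀ then -min (min (j : ℤ) (k - j)) (min ((i : ℕ) : ℤ) (k - (i : ℕ))) else 0 := by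
  have h1 := i.2.1
  have h2 := i.2.2
  rcases Nat.eq_zero_or_pos j with rfl | h0
  · simp only [subPath_zero, tent, Sum.elim_inl, Pi.zero_apply]
    split_ifs <;> omega
  · rcases hj.eq_or_lt with rfl | h3
    · simp only [subPath_last a b h0, tent, Sum.elim_inl, Pi.zero_apply]
      split_ifs <;> omega
    · rw [subPath_mid a b e ⟨j, h0, h3⟩]
      simp [tent]

lemma subLap_tent_inl (hk : 0 < k) (e₀ : E) (i : Set.Ioo 0 k) (v : V) :
    subLap a b k (tent k e₀ i) (.inl v) =
      (if a e₀ = v then 1 else 0) + (if b e₀ = v then 1 else 0) := by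
  have h1 := i.2.1
  have h2 := i.2.2
  rw [subLap_inl a b hk, Finset.sum_eq_single e₀]
  · rw [tent_subPath a b e₀ e₀ i (Nat.zero_le k), tent_subPath a b e₀ e₀ i hk,
      tent_subPath a b e₀ e₀ i le_rfl, tent_subPath a b e₀ e₀ i (Nat.sub_le k 1)]
    simp only [if_true]
    push_cast [Nat.cast_sub hk]
    congr 2 <;> omega
  · intro e _ he
    rw [tent_subPath a b e₀ e i (Nat.zero_le k), tent_subPath a b e₀ e i hk,
      tent_subPath a b e₀ e i le_rfl, tent_subPath a b e₀ e i (Nat.sub_le k 1)]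
    simp [he]
  · simp

/-- The two chips land at positions `i` and `k - i`. Only the one at `i` is recorded, and if the
positions coincide the left side is `-2`, hence an inequality. -/
lemma subLap_tent_inr (e₀ e : E) (i j : Set.Ioo 0 k) :
    subLap a b k (tent k e₀ i) (.inr (e, j)) ≤ if e = e₀ ∧ j = i then -1 else 0 := by
  have h1 := i.2.1
  have h2 := i.2.2
  have h3 := j.2.1
  have h4 := j.2.2
  rw [subLap_inr, tent_subPath a b e₀ e i h4.le, tent_subPath a b e₀ e i h4,
    tent_subPath a b e₀ e i (by omega)]
  push_cast [Nat.cast_sub h3]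
  by_cases he : e = e₀
  · simp only [he, if_true, true_and, Subtype.ext_iff]
    split_ifs <;> omega
  · simp [he]

lemma HasBasePointFree.subdivision [Fintype V] (hab : ∀ e, a e ≠ b e) (hk : 0 < k) {d : ℤ}
    (h : HasBasePointFree a b d) :
    HasBasePointFree (fun p : E × Fin k => subPath a b k p.1 p.2)
      (fun p => subPath a b k p.1 (p.2 + 1)) d := by
  obtain ⟨D, hD, hf⟩ := h
  have hle {f : V → ℤ} (h : lap a b f ≤ D) :
      subLap a b k (interpolate a b k f) ≤ Sum.elim D 0 := by
    rw [subLap_interpolate a b hk]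
    exact Sum.elim_le_elim_iff.2 ⟨h, le_rfl⟩
  change ∃ D : V ⊕ E × Set.Ioo 0 k → ℤ, ∑ x, D x = d ∧
    ∀ x, ∃ f, subLap a b k f ≤ D ∧ subLap a b k f x + 1 ≤ D x
  refine ⟨Sum.elim D 0, by simpa using hD, ?_⟩
  rintro (v | ⟨e, i⟩)
  · obtain ⟨f, h1, h2⟩ := hf v
    refine ⟨_, hle h1, ?_⟩
    simpa [subLap_interpolate a b hk] using h2
  · obtain ⟨f, hf1, hf2⟩ := hf (a e)
    obtain ⟨g, hg1, hg2⟩ := hf (b e)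
    have h1 := i.2.1
    have h2 := i.2.2
    -- With equal slopes, a constant shift makes `g` agree with `f` at both ends of `e`. The maximum
    -- then leaves a chip at each end, and `tent` carries these two chips inward. As the ends are
    -- distinct, one chip at each is enough.
    by_cases hs : f (b e) - f (a e) = g (b e) - g (a e)
    · let g' : V → ℤ := g + fun _ => f (a e) - g (a e)
      have hg' : lap a b g' = lap a b g := lap_add_const a b g _
      let m : V → ℤ := fun v => max (f v) (g' v)
      have hga : g' (a e) = f (a e) := by simp [g']
      have hgb : g' (b e) = f (b e) := by simp [g']; omega
      have hm : lap a b m ≤ D := lap_max_le a b f g' D hf1 (hg' ▸ hg1)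
      have hma : lap a b m (a e) ≤ _ := lap_max_le_left a b f g' _ hga.le
      have hmb : lap a b m (b e) ≤ _ := lap_max_le_right a b f g' _ hgb.ge
      rw [hg'] at hmb
      refine ⟨interpolate a b k m + tent k e i, ?_, ?_⟩
      · rw [subLap_add, subLap_interpolate a b hk]
        rintro (v | ⟨e', j⟩)
        · have h3 : lap a b m v ≤ D v := hm v
          have h4 := hab e
          rw [Pi.add_apply, subLap_tent_inl a b hk]
          simp only [Sum.elim_inl]
          split_ifs with h5 h6 h6
          · exact absurd (h5.trans h6.symm) h4
          · subst h5; omega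
          · subst h6; omega
          · omega
        · have h3 := subLap_tent_inr a b e e' i j
          rw [Pi.add_apply]
          simp only [Sum.elim_inr, Pi.zero_apply]
          split_ifs at h3 <;> omega
      · rw [subLap_add, subLap_interpolate a b hk]
        have h3 := subLap_tent_inr a b e e i i
        simp only [and_self, if_true] at h3
        simp only [Pi.add_apply, Sum.elim_inr, Pi.zero_apply]
        omega
    -- With different slopes, the interpolations are shifted to cross at `(e, i)`; their maximum
    -- bends upward there, which produces a chip.
    · let F := interpolate a b k f
      let c : ℤ := F (.inr (e, i)) - interpolate a b k g (.inr (e, i))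
      let H : V ⊕ E × Set.Ioo 0 k → ℤ := interpolate a b k g + fun _ => c
      have hH : subLap a b k H = subLap a b k (interpolate a b k g) := subLap_add_const a b _ c
      refine ⟨fun v => max (F v) (H v), lap_max_le _ _ F H _ (hle hf1) (hH.le.trans (hle hg1)), ?_⟩
      have hF : ∀ j ≤ k, F (subPath a b k e j) = (k - j) * f (a e) + j * f (b e) :=
        fun j hj => interpolate_subPath a b hk f e hj
      have hHH : ∀ j ≤ k, H (subPath a b k e j) = (k - j) * g (a e) + j * g (b e) + c :=
        fun j hj => by simp only [H, Pi.add_apply, interpolate_subPath a b hk g e hj]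
      have hc : (k - (i : ℕ)) * f (a e) + (i : ℕ) * f (b e)
          = (k - (i : ℕ)) * g (a e) + (i : ℕ) * g (b e) + c := by
        simp only [c, F, interpolate, Sum.elim_inr]; ring
      rw [subLap_inr, hF _ h2.le, hF _ h2, hF _ (by omega), hHH _ h2.le, hHH _ h2, hHH _ (by omega)]
      push_cast [Nat.cast_sub h1]
      simp only [Sum.elim_inr, Pi.zero_apply]
      have hp (u v : ℤ) : (k - ((i : ℕ) + 1)) * u + ((i : ℕ) + 1) * v
          = (k - (i : ℕ)) * u + (i : ℕ) * v + (v - u) := by ring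
      have hm (u v : ℤ) : (k - ((i : ℕ) - 1)) * u + ((i : ℕ) - 1) * v
          = (k - (i : ℕ)) * u + (i : ℕ) * v - (v - u) := by ring
      rw [hp, hp, hm, hm]
      generalize ((k : ℤ) - (i : ℕ)) * f (a e) + (i : ℕ) * f (b e) = X at *
      generalize ((k : ℤ) - (i : ℕ)) * g (a e) + (i : ℕ) * g (b e) = Y at *
      omega

end Forward

/-! ### Sequences with one unit of concavity -/

lemma slope_lower_bound {k i : ℕ} (hi : 0 < i) {h : ℕ → ℤ}
    (hh : ∀ j, 0 < j → j < k → 2 * h j - h (j - 1) - h (j + 1) ≤ if j = i then 1 else 0) (n : ℕ)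
    (hn : n < k) : h 1 - h 0 - (if i ≤ n then 1 else 0) ≤ h (n + 1) - h n := by
  induction n with
  | zero => simp [hi.ne']
  | succ n ih =>
    have h1 := ih (by omega)
    have h2 := hh (n + 1) n.succ_pos hn
    simp only [Nat.add_sub_cancel] at h2
    split_ifs at * <;> omega

/-- A sequence that is convex except for one unit of concavity at `i` lies above its tangent at `0`,
up to the distance from `i`. -/
lemma le_of_almost_convex {k i : ℕ} (hi : 0 < i) {h : ℕ → ℤ}
    (hh : ∀ j, 0 < j → j < k → 2 * h j - h (j - 1) - h (j + 1) ≤ if j = i then 1 else 0) (n : ℕ)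
    (hn : n ≤ k) : h 0 + n * (h 1 - h 0) - (n - i : ℕ) ≤ h n := by
  induction n with
  | zero => simp
  | succ n ih =>
    have h1 := ih (by omega)
    have h2 := slope_lower_bound hi hh n hn
    push_cast
    rw [add_mul, one_mul]
    split_ifs at h2 <;> omega

lemma almost_convex_reverse {k i : ℕ} {h : ℕ → ℤ} (hik : i ≤ k)
    (hh : ∀ j, 0 < j → j < k → 2 * h j - h (j - 1) - h (j + 1) ≤ if j = i then 1 else 0) (j : ℕ)
    (h0 : 0 < j) (hj : j < k) :
    2 * h (k - j) - h (k - (j - 1)) - h (k - (j + 1)) ≤ if j = k - i then 1 else 0 := by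
  have h1 := hh (k - j) (by omega) (by omega)
  rw [show k - j - 1 = k - (j + 1) by omega, show k - j + 1 = k - (j - 1) by omega] at h1
  split_ifs at * <;> omega

/-! ### From the subdivision back to the graph -/

section Backward

variable {V E : Type*}

/-- The retraction of the subdivision to the vertices of the graph that moves the interior points
of the edge `e` to `a e`. -/
def retract (a : E → V) (k : ℕ) : V ⊕ E × Set.Ioo 0 k → V := Sum.elim id fun p => a p.1

variable (a b : E → V) {k : ℕ}

variable [DecidableEq V] [Fintype E] [DecidableEq E]

/-- If `A + (z)` minus the divisor of `F` is effective on the subdivision, then its restriction to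
the old vertices is dominated by `A + (retract z)` minus the divisor of a rounding of `F`. -/
lemma exists_rounding (hk : 0 < k) (A : V → ℤ) (z : V ⊕ E × Set.Ioo 0 k)
    (F : V ⊕ E × Set.Ioo 0 k → ℤ) (hF : subLap a b k F ≤ Sum.elim A 0 + Pi.single z 1) :
    ∃ g : V → ℤ, ∀ v, lap a b g v +
      ((Sum.elim A 0 + Pi.single z 1 : V ⊕ E × Set.Ioo 0 k → ℤ) (.inl v) - subLap a b k F (.inl v))
        ≤ (A + Pi.single (retract a k z) 1 : V → ℤ) v := by
  have hk' : (0 : ℤ) < k := by exact_mod_cast hk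
  -- On the edge containing `z`, the value at `a e` becomes `0`, so rounding is exact at that end;
  -- this absorbs the defect caused by the concavity.
  wlog h0 : F (.inl (retract a k z)) = 0 generalizing F
  · have hs : subLap a b k (F + fun _ => -F (.inl (retract a k z))) = subLap a b k F := 
      subLap_add_const a b F _
    have := this (F + fun _ => -F (.inl (retract a k z))) (hs ▸ hF) (by simp)
    rwa [hs] at this
  -- Here `i` is the position of `z` on the path of `e`. The value `i = k` means that `z` is not
  -- inside `e`; no interior point is then exceptional and `F` is convex there.
  have key (e : E) : ∃ i, 0 < i ∧ (∀ j, 0 < j → j < k → 2 * F (subPath a b k e j)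
      - F (subPath a b k e (j - 1)) - F (subPath a b k e (j + 1)) ≤ if j = i then 1 else 0) ∧
      (i = k ∧ (¬ ∃ i, z = .inr (e, i)) ∨ i < k ∧ ∃ hi, z = .inr (e, ⟨i, hi⟩)) := by
    have hF' (j : Set.Ioo 0 k) := (subLap_inr a b F e j).symm.le.trans (hF (.inr (e, j)))
    by_cases hz : ∃ i, z = .inr (e, i)
    · obtain ⟨i, rfl⟩ := hz
      refine ⟨i, i.2.1, fun j hj hj' => ?_, .inr ⟨i.2.2, i.2, rfl⟩⟩
      have := hF' ⟨j, hj, hj'⟩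
      simpa [Pi.single_apply, Subtype.ext_iff] using this
    · refine ⟨k, hk, fun j hj hj' => ?_, .inl ⟨rfl, hz⟩⟩
      have := hF' ⟨j, hj, hj'⟩
      rw [Pi.add_apply, Pi.single_eq_of_ne (fun h => hz ⟨_, h.symm⟩)] at this
      simpa [hj'.ne] using this
  have hdiv {x y s : ℤ} (h : x + k * s ≤ y) : x / k + s ≤ y / k := by
    rw [← Int.add_mul_ediv_left _ _ hk'.ne']
    exact Int.ediv_le_ediv hk' h
  have edge (e : E) :
      F (.inl (a e)) / k - F (.inl (b e)) / k ≤ F (subPath a b k e 0) - F (subPath a b k e 1) +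
        (if ∃ i, z = .inr (e, i) then 1 else 0) ∧
      F (.inl (b e)) / k - F (.inl (a e)) / k ≤
        F (subPath a b k e k) - F (subPath a b k e (k - 1)) := by
    obtain ⟨i, hi, hc, hik⟩ := key e
    have hle : i ≤ k := by omega
    have h1 := le_of_almost_convex (h := fun j => F (subPath a b k e j)) hi hc k le_rfl
    rw [subPath_zero, subPath_last a b hk] at h1 ⊢
    rcases hik with ⟨rfl, hz⟩ | ⟨hlt, hi', rfl⟩
    · have h2 := le_of_almost_convex (h := fun j => F (subPath a b i e (i - j))) (i := i) hi
        (fun j h3 h4 => by simpa [h4.ne, h3.ne'] using almost_convex_reverse le_rfl hc j h3 h4)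
        i le_rfl
      simp only [Nat.sub_self, Nat.sub_zero, subPath_zero, subPath_last a b hk] at h1 h2
      rw [if_neg hz]
      constructor
      · have := hdiv (x := F (.inl (a e))) (y := F (.inl (b e)))
          (s := F (subPath a b i e 1) - F (.inl (a e))) (by push_cast at h1; linarith)
        linarith
      · have := hdiv (x := F (.inl (b e))) (y := F (.inl (a e)))
          (s := F (subPath a b i e (i - 1)) - F (.inl (b e))) (by push_cast at h2; linarith)
        linarith
    · have h2 := le_of_almost_convex (h := fun j => F (subPath a b k e (k - j))) (i := k - i)
        (by omega) (almost_convex_reverse hle hc) k le_rfl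
      simp only [Nat.sub_self, Nat.sub_zero, subPath_zero, subPath_last a b hk] at h1 h2
      simp only [retract, Sum.elim_inr] at h0
      rw [h0] at h1 h2 ⊢
      rw [if_pos ⟨_, rfl⟩, Int.zero_ediv]
      push_cast [Nat.cast_sub hle, Nat.sub_sub_self hle] at h1 h2
      constructor
      -- The concavity costs `k - i`, here bounded by `k`: one unit after division, paid for by the
      -- chip moved from `z` to `a e`.
      · have := hdiv (x := 0) (y := F (.inl (b e))) (s := F (subPath a b k e 1) - 1)
          (by rw [mul_sub]; linarith)
        rw [Int.zero_ediv] at this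
        linarith
      -- Seen from `b e` the concavity costs `i < k`, which rounding down absorbs, so no chip is
      -- needed at `b e`.
      · have := Int.ediv_lt_of_lt_mul (a := F (.inl (b e)))
          (b := F (.inl (b e)) - F (subPath a b k e (k - 1)) + 1) hk' (by
            rw [add_mul, sub_mul]; rw [mul_sub] at h2; linarith)
        omega
  refine ⟨fun v => F (.inl v) / k, fun v => ?_⟩
  have hsum : (Pi.single (retract a k z) 1 : V → ℤ) v
      = (Pi.single z 1 : V ⊕ E × Set.Ioo 0 k → ℤ) (.inl v) +
        ∑ e, if a e = v then (if ∃ i, z = .inr (e, i) then 1 else 0) else 0 := by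
    rcases z with w | ⟨e, i⟩
    · simp [retract, Pi.single_apply]
    · rw [Finset.sum_eq_single e]
      · simp [retract, Pi.single_apply, eq_comm]
      · intro e' _ he
        simp [he.symm]
      · simp
  have : lap a b (fun v => F (.inl v) / k) v ≤ subLap a b k F (.inl v) +
      ∑ e, if a e = v then (if ∃ i, z = .inr (e, i) then 1 else 0) else 0 := by
    rw [subLap_inl a b hk, ← Finset.sum_add_distrib]
    refine Finset.sum_le_sum fun e _ => ?_
    have := edge e
    beta_reduce
    split_ifs at * <;> omega
  simp only [Pi.add_apply, Sum.elim_inl, hsum]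
  omega

lemma HasBasePointFree.of_add_single [Fintype V] (hk : 0 < k) (A : V → ℤ)
    (z : V ⊕ E × Set.Ioo 0 k)
    (h : ∀ v, ∃ F, subLap a b k F ≤ Sum.elim A 0 + Pi.single z 1 ∧
      subLap a b k F (.inl v) + 1 ≤ 
        (Sum.elim A 0 + Pi.single z 1 : V ⊕ E × Set.Ioo 0 k → ℤ) (.inl v)) :
    HasBasePointFree a b (∑ v, A v + 1) := by
  refine ⟨A + Pi.single (retract a k z) 1, by simp [Finset.sum_add_distrib], fun v => ?_⟩
  obtain ⟨F, hF, hv⟩ := h v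
  obtain ⟨g, hg⟩ := exists_rounding a b hk A z F hF
  refine ⟨g, fun w => ?_, ?_⟩
  · change lap a b g w ≤ (A + Pi.single (retract a k z) 1 : V → ℤ) w
    have h1 := hg w
    have h2 : subLap a b k F (.inl w) ≤
      (Sum.elim A 0 + Pi.single z 1 : V ⊕ E × Set.Ioo 0 k → ℤ) (.inl w) := hF (.inl w)
    omega
  · have h1 := hg v
    omega

lemma HasBasePointFree.of_subdivision [Fintype V] [Nonempty V] (hk : 0 < k) {d : ℤ}
    (hd : d = 1 ∨ d = 2)
    (h : HasBasePointFree (fun p : E × Fin k => subPath a b k p.1 p.2)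
      (fun p => subPath a b k p.1 (p.2 + 1)) d) :
    HasBasePointFree a b d := by
  obtain ⟨D, hD, hf⟩ := h
  change ∀ x, ∃ f, subLap a b k f ≤ D ∧ subLap a b k f x + 1 ≤ D x at hf
  obtain ⟨x⟩ := ‹Nonempty V›
  obtain ⟨F₀, h1, h2⟩ := hf (.inl x)
  have h3 : 0 ≤ D - subLap a b k F₀ - Pi.single (.inl x) 1 := fun w => by
    have := h1 w
    rcases eq_or_ne w (.inl x) with rfl | hw
    · simp only [Pi.zero_apply, Pi.sub_apply, Pi.single_eq_same]; omega
    · simpa [hw] using this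
  have h4 : ∑ w, (D - subLap a b k F₀ - Pi.single (.inl x) 1 : _ → ℤ) w = d - 1 := by
    simp only [Pi.sub_apply, Finset.sum_sub_distrib, hD, sum_lap, Finset.sum_pi_single',
      Finset.mem_univ, if_true]
    simp
  -- Subtracting `F₀` from every function replaces `D` by the equivalent effective divisor `D -
  -- subLap a b k F₀`, which contains the old vertex `x`.
  have key (A : V → ℤ) (z : V ⊕ E × Set.Ioo 0 k)
      (hA : D - subLap a b k F₀ = Sum.elim A 0 + Pi.single z 1) :
      HasBasePointFree a b (∑ v, A v + 1) := by
    refine HasBasePointFree.of_add_single a b hk A z fun v => ?_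
    obtain ⟨F, h5, h6⟩ := hf (.inl v)
    have hs : subLap a b k (F - F₀) = subLap a b k F - subLap a b k F₀ := lap_sub _ _ F F₀
    refine ⟨F - F₀, ?_, ?_⟩
    · rw [hs, ← hA]
      exact sub_le_sub_right h5 _
    · rw [hs, ← hA]
      simp only [Pi.sub_apply]
      omega
  rcases hd with rfl | rfl
  · have := (Fintype.sum_eq_zero_iff_of_nonneg h3).1 (by simpa using h4)
    simpa using key 0 (.inl x) (by rw [sub_eq_zero.1 this]; ext w; rcases w with w | w <;> simp)
  · obtain ⟨z, hz⟩ := eq_single_of_sum_eq_one h3 (by simpa using h4)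
    have := key (Pi.single x 1) z (by
      rw [← hz]; ext w; rcases w with w | w <;> simp [Pi.single_apply])
    simpa using this

end Backward

end Graph

theorem mainTheorem9 {α β : Type*} (G : Graph α β) (hV : V(G).Finite) (hE : E(G).Finite)
    (hloop : G.Loopless) (hconn : G.toSimpleGraph.Connected) (k : ℕ) (hk : 0 < k) :
    G.IsHyperelliptic ↔ (G.subdivision k).IsHyperelliptic := by
  classical
  have := hV.fintype
  have := hE.fintype
  have : Nonempty V(G) := hconn.nonempty
  have hab (e : E(G)) : G.firstEnd e ≠ G.secondEnd e := fun h => by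
    have := G.isLink_firstEnd_secondEnd e
    rw [← h] at this
    exact hloop.not_isLoopAt _ _ this
  rw [Graph.isHyperelliptic_iff G (Equiv.refl _) (Equiv.refl _) G.firstEnd G.secondEnd
      G.isLink_firstEnd_secondEnd,
    Graph.isHyperelliptic_iff (G.subdivision k) (Equiv.Set.univ _).symm (Equiv.Set.univ _).symm
      (fun p => Graph.subPath G.firstEnd G.secondEnd k p.1 p.2)
      (fun p => Graph.subPath G.firstEnd G.secondEnd k p.1 (p.2 + 1)) (fun p => rfl)]
  have h {d : ℤ} (hd : d = 1 ∨ d = 2) := Iff.intro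
    (Graph.HasBasePointFree.subdivision G.firstEnd G.secondEnd (d := d) hab hk)
    (Graph.HasBasePointFree.of_subdivision G.firstEnd G.secondEnd hk hd)
  rw [h (.inl rfl), h (.inr rfl)]
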